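/- Let $(M,\pi)$ be a Poisson manifold, i.e. a smooth (finite-dimensional, Hausdorff, second countable) manifold $M$ with a smooth bivector field $\pi$ such that the bracket $\{f,g\}=\pi(df,dg)$ on $C^\infty(M)$ satisfies the Jacobi identity, and let $\pi^\sharp : T^*M\to TM$ be given by $\beta(\pi^\sharp\alpha)=\pi(\alpha,\beta)$. A symplectic leaf of $(M,\pi)$ is a connected (second countable) immersed submanifold $\iota : S\hookrightarrow M$, that is, the image of an injective smooth immersion, with $d\iota(T_yS)=\pi^\sharp(T^*_{\iota(y)}M)$ for all $y\in S$, that is maximal with respect to inclusion among such immersed submanifolds. If $S$ is a symplectic leaf whose image $\iota(S)$ is a closed subset of $M$, then $S$ is an embedded submanifold of $M$, i.e. $\iota : S\to M$ is a smooth embedding (an immersion that is a homeomorphism onto its image with the subspace topology). -/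

import Mathlib

open scoped Manifold ContDiff

/-- The bracket `{f, g} = π(df, dg) = dg(π♯ df)` determined by a field of linear maps
`π♯_x : T_x^*M → T_xM`. -/
noncomputable def bivectorBracket {n : ℕ} {M : Type*} [TopologicalSpace M]
    [ChartedSpace (EuclideanSpace ℝ (Fin n)) M]
    (sharp : ∀ x : M, (TangentSpace (𝓡 n) x →L[ℝ] ℝ) →ₗ[ℝ] TangentSpace (𝓡 n) x)
    (f g : M → ℝ) (x : M) : ℝ :=
  mvfderiv (𝓡 n) g x (sharp x (mvfderiv (𝓡 n) f x))

/-- A Poisson structure on a smooth `n`-manifold `M`: a smooth bivector field `π`, given by the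
skew maps `π♯_x : T_x^*M → T_xM`, `β(π♯ α) = π(α, β)`, whose bracket of smooth functions satisfies
the Jacobi identity (equivalently `[π, π] = 0`). On a Hausdorff `M` differentials of smooth functions span every
cotangent space, so `π` is smooth exactly when all Hamiltonian vector fields `π♯ df` are. -/
structure PoissonStructure (n : ℕ) (M : Type*) [TopologicalSpace M]
    [ChartedSpace (EuclideanSpace ℝ (Fin n)) M] [IsManifold (𝓡 n) ∞ M] where
  /-- The map `π♯_x : T_x^*M → T_xM`. -/
  sharp : ∀ x : M, (TangentSpace (𝓡 n) x →L[ℝ] ℝ) →ₗ[ℝ] TangentSpace (𝓡 n) x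
  skew : ∀ (x : M) (α β : TangentSpace (𝓡 n) x →L[ℝ] ℝ), β (sharp x α) = -α (sharp x β)
  smooth : ∀ f : M → ℝ, ContMDiff (𝓡 n) 𝓘(ℝ, ℝ) ∞ f →
    ContMDiff (𝓡 n) (𝓡 n).tangent ∞
      (fun x ↦ (⟨x, sharp x (mvfderiv (𝓡 n) f x)⟩ : TangentBundle (𝓡 n) M))
  jacobi : ∀ f g h : M → ℝ, ContMDiff (𝓡 n) 𝓘(ℝ, ℝ) ∞ f → ContMDiff (𝓡 n) 𝓘(ℝ, ℝ) ∞ g →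
    ContMDiff (𝓡 n) 𝓘(ℝ, ℝ) ∞ h → ∀ x : M,
      bivectorBracket sharp f (bivectorBracket sharp g h) x
        + bivectorBracket sharp g (bivectorBracket sharp h f) x
        + bivectorBracket sharp h (bivectorBracket sharp f g) x = 0

universe u v

namespace PoissonStructure

/-- A (connected) integral manifold of the characteristic distribution `im π♯`: an immersed
submanifold `ι : L → M`, i.e. an injective smooth immersion of a connected second countable
manifold, whose tangent space at each point is `im π♯`. -/
structure IsIntegralManifold {n : ℕ} {M : Type*} [TopologicalSpace M]
    [ChartedSpace (EuclideanSpace ℝ (Fin n)) M] [IsManifold (𝓡 n) ∞ M]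
    (P : PoissonStructure n M) {d : ℕ} {L : Type*} [TopologicalSpace L]
    [ChartedSpace (EuclideanSpace ℝ (Fin d)) L] [IsManifold (𝓡 d) ∞ L] (ι : L → M) : Prop where
  connectedSpace : ConnectedSpace L
  secondCountable : SecondCountableTopology L
  injective : Function.Injective ι
  isImmersion : Manifold.IsImmersion (𝓡 d) (𝓡 n) ∞ ι
  tangent_eq : ∀ y : L,
    LinearMap.range (mfderiv (𝓡 d) (𝓡 n) ι y).toLinearMap = LinearMap.range (P.sharp (ι y))

/-- A symplectic leaf: a connected integral manifold of `im π♯` which is maximal with respect to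
inclusion. An integral manifold injects into `M`, so it suffices to compare with integral
manifolds in the universe of `M`. -/
structure IsSymplecticLeaf {n : ℕ} {M : Type u} [TopologicalSpace M]
    [ChartedSpace (EuclideanSpace ℝ (Fin n)) M] [IsManifold (𝓡 n) ∞ M]
    (P : PoissonStructure n M) {d : ℕ} {L : Type v} [TopologicalSpace L]
    [ChartedSpace (EuclideanSpace ℝ (Fin d)) L] [IsManifold (𝓡 d) ∞ L] (ι : L → M) : Prop where
  isIntegralManifold : P.IsIntegralManifold (d := d) ι
  maximal : ∀ (k : ℕ) (N : Type u) [TopologicalSpace N]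
    [ChartedSpace (EuclideanSpace ℝ (Fin k)) N] [IsManifold (𝓡 k) ∞ N] (j : N → M),
    P.IsIntegralManifold (d := k) j → Set.range ι ⊆ Set.range j → Set.range j ⊆ Set.range ι

end PoissonStructure

/-! Call `y : L` good if `comap ι (𝓝 (ι y)) ≤ 𝓝 y`, that is, if points of `L` whose images approach
`ι y` approach `y` in `L`. An injective immersion is an embedding as soon as every point is good. As
`L` is connected, it suffices that the good set is open, nonempty and closed. Openness is local
compactness; nonemptiness is Baire's theorem on the closed range (`exists_comap_nhds_le`).

For closedness, a good set with a bad limit point contains, in a chart, a ball touching a bad point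
`q`. The vector from `q` to the centre is tangent to the leaf, hence is the value at `q` of a
Hamiltonian field, whose flow carries `q` into the ball at once. Goodness then travels back to `q`
(`IsAdaptedCharts.exists_curve_comap_nhds_le`): the field is tangent to the leaf and the range is
closed, so the flow on `M` preserves the range; flow forward in `M`, lift to `L` near the good
point, flow back in `L`. -/

open Set Filter Topology Metric

/-! ### Points where an injection is inducing; Baire's theorem -/

section Topology

variable {L M : Type*} [TopologicalSpace L] [TopologicalSpace M] [T2Space M] {ι : L → M}

/-- If `ι⁻¹(U)` lies in a compact set, then the injective map `ι` is inducing over `U`. -/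
theorem comap_nhds_le_of_preimage_subset_isCompact (hc : Continuous ι) (hi : Function.Injective ι)
    {K : Set L} (hK : IsCompact K) {y : L} {U : Set M} (hU : U ∈ 𝓝 (ι y)) (hUK : ι ⁻¹' U ⊆ K) :
    comap ι (𝓝 (ι y)) ≤ 𝓝 y := by
  intro N hN
  obtain ⟨O, hON, hO, hyO⟩ := mem_nhds_iff.1 hN
  have hcl : IsClosed (ι '' (K \ O)) := ((hK.diff hO).image hc).isClosed
  have hmem : (ι '' (K \ O))ᶜ ∈ 𝓝 (ι y) := by
    refine hcl.isOpen_compl.mem_nhds ?_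
    rintro ⟨y', ⟨-, h2⟩, h3⟩
    exact h2 (hi h3 ▸ hyO)
  refine mem_comap.2 ⟨_, inter_mem hU hmem, fun x hx ↦ hON ?_⟩
  by_contra hxO
  exact hx.2 ⟨x, ⟨hUK hx.1, hxO⟩, rfl⟩

/-- The compact neighbourhood that witnesses goodness of `y` serves for all nearby points too. -/
theorem isOpen_setOf_comap_nhds_le [WeaklyLocallyCompactSpace L] (hc : Continuous ι)
    (hi : Function.Injective ι) : IsOpen {y | comap ι (𝓝 (ι y)) ≤ 𝓝 y} := by
  rw [isOpen_iff_mem_nhds]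
  intro y hy
  obtain ⟨K, hK, hKy⟩ := exists_compact_mem_nhds y
  obtain ⟨U, hU, hUK⟩ := mem_comap.1 (hy hKy)
  obtain ⟨O, hOU, hO, hyO⟩ := mem_nhds_iff.1 hU
  filter_upwards [hc.continuousAt.preimage_mem_nhds (hO.mem_nhds hyO)] with y' hy'
  exact comap_nhds_le_of_preimage_subset_isCompact hc hi hK (hO.mem_nhds hy')
    ((preimage_mono hOU).trans hUK)

/-- A continuous injection of a `σ`-compact space with closed range in a locally compact Hausdorff
space is inducing at some point, by Baire's theorem. -/
theorem exists_comap_nhds_le [SigmaCompactSpace L] [Nonempty L] [LocallyCompactSpace M]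
    (hc : Continuous ι) (hi : Function.Injective ι) (hcl : IsClosed (range ι)) :
    ∃ y, comap ι (𝓝 (ι y)) ≤ 𝓝 y := by
  -- Closedness enters here: it makes the range a Baire space.
  have : LocallyCompactSpace (range ι) := hcl.isClosedEmbedding_subtypeVal.locallyCompactSpace
  have : Nonempty (range ι) := ⟨⟨_, mem_range_self (Classical.arbitrary L)⟩⟩
  let f : L → range ι := fun y ↦ ⟨ι y, mem_range_self y⟩
  have hf : Continuous f := hc.subtype_mk _
  obtain ⟨k, x, hx⟩ := nonempty_interior_of_iUnion_of_closed
    (f := fun k ↦ f '' compactCovering L k)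
    (fun k ↦ ((isCompact_compactCovering L k).image hf).isClosed) (by
      rw [← image_iUnion, iUnion_compactCovering, image_univ, range_eq_univ]
      rintro ⟨_, y, rfl⟩
      exact ⟨y, rfl⟩)
  obtain ⟨y, hy⟩ := x.2
  obtain rfl : f y = x := Subtype.ext hy
  obtain ⟨U, hU, hUf⟩ := mem_nhds_induced _ _ _ |>.1 (mem_interior_iff_mem_nhds.1 hx)
  refine ⟨y, comap_nhds_le_of_preimage_subset_isCompact hc hi (isCompact_compactCovering L k) hU ?_⟩
  intro y' hy'
  obtain ⟨y'', h1, h2⟩ := hUf (show f y' ∈ _ from hy')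
  exact hi (congrArg Subtype.val h2) ▸ h1

end Topology

/-! ### Local flows in normed spaces -/

section ODE

variable {E F : Type*} [NormedAddCommGroup E] [NormedSpace ℝ E] [CompleteSpace E]
  [NormedAddCommGroup F] [NormedSpace ℝ F] [CompleteSpace F]

/-- A `C¹` vector field has a continuous local flow with values in a prescribed neighbourhood. -/
theorem ContDiffAt.exists_continuousOn_flow {f : E → E} {x₀ : E} (hf : ContDiffAt ℝ 1 f x₀)
    {U : Set E} (hU : U ∈ 𝓝 x₀) :
    ∃ α : E → ℝ → E, ∃ r > 0, ∃ ε > 0,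
      (∀ x ∈ ball x₀ r, α x 0 = x ∧
        ∀ t ∈ Ioo (-ε) ε, HasDerivAt (α x) (f (α x t)) t ∧ α x t ∈ U) ∧
      ∀ t ∈ Ioo (-ε) ε, ContinuousOn (fun x ↦ α x t) (ball x₀ r) := by
  obtain ⟨ε, hε, a, r, L, K, hr, hpl⟩ := IsPicardLindelof.of_contDiffAt_one hf
  obtain ⟨α, h1, h2⟩ :=
    (hpl 0).exists_forall_mem_closedBall_eq_hasDerivWithinAt_continuousOn
  simp only [zero_sub, zero_add] at h1 h2
  have hr' : (0 : ℝ) < r := hr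
  have hc : ContinuousAt α (x₀, 0) := h2.continuousAt
    (prod_mem_nhds (closedBall_mem_nhds _ hr') (Icc_mem_nhds (by linarith) hε))
  have hx₀ : α (x₀, 0) = x₀ := (h1 x₀ (mem_closedBall_self hr'.le)).1
  have hUα : α ⁻¹' U ∈ 𝓝 x₀ ×ˢ 𝓝 (0 : ℝ) := by
    rw [← nhds_prod_eq]
    exact hc.preimage_mem_nhds (by rwa [hx₀])
  obtain ⟨A, hA, B, hB, hAB⟩ := mem_prod_iff.1 hUα
  obtain ⟨r', hr'0, hrA⟩ := Metric.mem_nhds_iff.1 hA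
  obtain ⟨ε', hε'0, hεB⟩ := Metric.mem_nhds_iff.1 hB
  rw [Real.ball_eq_Ioo, zero_sub, zero_add] at hεB
  refine ⟨fun x t ↦ α (x, t), min r r', lt_min hr' hr'0, min ε ε', lt_min hε hε'0, ?_, ?_⟩
  · intro x hx
    have hxr : x ∈ closedBall x₀ r :=
      ball_subset_closedBall (ball_subset_ball (min_le_left _ _) hx)
    refine ⟨(h1 x hxr).1, fun t ht ↦ ⟨?_, ?_⟩⟩
    · have ht' : t ∈ Ioo (-ε) ε :=
        ⟨by linarith [ht.1, min_le_left ε ε'], by linarith [ht.2, min_le_left ε ε']⟩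
      exact ((h1 x hxr).2 t (Ioo_subset_Icc_self ht')).hasDerivAt (Icc_mem_nhds ht'.1 ht'.2)
    · exact hAB (mk_mem_prod (hrA (ball_subset_ball (min_le_right _ _) hx))
        (hεB ⟨by linarith [ht.1, min_le_right ε ε'], by linarith [ht.2, min_le_right ε ε']⟩))
  · intro t ht
    refine h2.comp (by fun_prop) fun x hx ↦ mk_mem_prod ?_ ?_
    · exact ball_subset_closedBall (ball_subset_ball (min_le_left _ _) hx)
    · exact ⟨by linarith [ht.1, min_le_left ε ε'], by linarith [ht.2, min_le_left ε ε']⟩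

/-- Let the linear injection `J` intertwine the vector fields `W` and `V` near `q`, and let `δ` be
the integral curve of `W` from `q`. For small `T > 0` the time `T` flow of `V` near `J q` and
the time `-T` flow `B` of `W` near `δ T` are inverse to each other along `J`. -/
theorem exists_intertwined_flows (J : F →L[ℝ] E) (hJ : Function.Injective J) {V : E → E}
    {W : F → F} {q : F} (hV : ContDiffAt ℝ 1 V (J q)) (hW : ContDiffAt ℝ 1 W q) {O : Set F}
    (hO : O ∈ 𝓝 q) (hVW : ∀ v ∈ O, J (W v) = V (J v)) {U : Set E} (hU : U ∈ 𝓝 (J q)) :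
    ∃ δ : ℝ → F, δ 0 = q ∧ (∀ᶠ t in 𝓝 0, HasDerivAt δ (W (δ t)) t) ∧
      ∀ᶠ T in 𝓝[>] (0 : ℝ), ∃ (A : E → ℝ → E) (B : F → F),
        (∀ᶠ u in 𝓝 (J q), A u 0 = u ∧
          ∀ t ∈ Icc 0 T, ∀ᶠ s in 𝓝 t, HasDerivAt (A u) (V (A u s)) s ∧ A u s ∈ U) ∧
        ContinuousAt (fun u ↦ A u T) (J q) ∧ A (J q) T = J (δ T) ∧
        ContinuousAt B (δ T) ∧ B (δ T) = q ∧ δ T ∈ O ∧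
        ∀ᶠ p in 𝓝 (J q) ×ˢ 𝓝 (δ T), J p.2 = A p.1 T → J (B p.2) = p.1 := by
  obtain ⟨K, s, hs, hlip⟩ := hV.exists_lipschitzOnWith
  -- Both flows are confined to the set `s` where `V` is Lipschitz, so that ODE uniqueness applies.
  obtain ⟨α, r₁, hr₁, ε₁, hε₁, hα, hαc⟩ := hV.exists_continuousOn_flow (inter_mem hU hs)
  obtain ⟨β, r₂, hr₂, ε₂, hε₂, hβ, hβc⟩ := hW.exists_continuousOn_flow
    (inter_mem hO (J.continuous.continuousAt.preimage_mem_nhds hs))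
  have hq := hβ q (mem_ball_self hr₂)
  have hJq := hα (J q) (mem_ball_self hr₁)
  have hδ : ContinuousAt (β q) 0 := (hq.2 0 ⟨by linarith, hε₂⟩).1.continuousAt
  have hJβ : ∀ v ∈ ball q r₂, ∀ t ∈ Ioo (-ε₂) ε₂,
      HasDerivAt (fun t ↦ J (β v t)) (V (J (β v t))) t := by
    intro v hv t ht
    have h := (hβ v hv).2 t ht
    rw [← hVW _ h.2.1]
    exact J.hasFDerivAt.comp_hasDerivAt t h.1
  refine ⟨β q, hq.1, ?_, ?_⟩
  · filter_upwards [Ioo_mem_nhds (neg_lt_zero.2 hε₂) hε₂] with t ht using (hq.2 t ht).1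
  have hball : ∀ᶠ T in 𝓝 (0 : ℝ), β q T ∈ ball q r₂ :=
    hδ.preimage_mem_nhds (by rw [hq.1]; exact ball_mem_nhds _ hr₂)
  filter_upwards [nhdsWithin_le_nhds hball, nhdsWithin_le_nhds (Iio_mem_nhds hε₁),
    nhdsWithin_le_nhds (Iio_mem_nhds hε₂), self_mem_nhdsWithin] with T hT hT₁ hT₂ hT₀
  simp only [mem_Iio, mem_Ioi] at hT₁ hT₂ hT₀
  have hAT : α (J q) T = J (β q T) := by
    refine ODE_solution_unique_of_mem_Icc_right (v := fun _ ↦ V) (s := fun _ ↦ s) (K := K)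
      (f := α (J q)) (g := fun t ↦ J (β q t)) (a := 0) (b := T) (fun _ _ ↦ hlip) ?_ ?_ ?_ ?_ ?_ ?_
      (by rw [hJq.1, hq.1]) (right_mem_Icc.2 hT₀.le)
    · exact fun t ht ↦ (hJq.2 t ⟨by linarith [ht.1], by linarith [ht.2]⟩).1.continuousAt
        |>.continuousWithinAt
    · exact fun t ht ↦ (hJq.2 t ⟨by linarith [ht.1], by linarith [ht.2]⟩).1.hasDerivWithinAt
    · exact fun t ht ↦ (hJq.2 t ⟨by linarith [ht.1], by linarith [ht.2]⟩).2.2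
    · exact fun t ht ↦ (hJβ q (mem_ball_self hr₂) t
        ⟨by linarith [ht.1], by linarith [ht.2]⟩).continuousAt.continuousWithinAt
    · exact fun t ht ↦ (hJβ q (mem_ball_self hr₂) t
        ⟨by linarith [ht.1], by linarith [ht.2]⟩).hasDerivWithinAt
    · exact fun t ht ↦ (hq.2 t ⟨by linarith [ht.1], by linarith [ht.2]⟩).2.2
  -- The curves `J (β v (t - T))` and `α u t` both solve the equation of `V` and agree at `t = T`;
  -- uniqueness backwards gives agreement at `0`.
  have hback : ∀ u ∈ ball (J q) r₁, ∀ v ∈ ball q r₂, J v = α u T → J (β v (-T)) = u := by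
    intro u hu v hv huv
    have hu' := hα u hu
    have hd : ∀ t ∈ Icc 0 T, HasDerivAt (fun t ↦ J (β v (t - T))) (V (J (β v (t - T)))) t :=
      fun t ht ↦ by
        simpa using! (hJβ v hv (t - T) ⟨by linarith [ht.1], by linarith [ht.2]⟩).comp_sub_const t T
    have := ODE_solution_unique_of_mem_Icc_left (v := fun _ ↦ V) (s := fun _ ↦ s) (K := K)
      (f := fun t ↦ J (β v (t - T))) (g := α u) (a := 0) (b := T) (fun _ _ ↦ hlip)
      (fun t ht ↦ (hd t ht).continuousAt.continuousWithinAt)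
      (fun t ht ↦ (hd t (Ioc_subset_Icc_self ht)).hasDerivWithinAt)
      (fun t ht ↦ ((hβ v hv).2 (t - T) ⟨by linarith [ht.1], by linarith [ht.2]⟩).2.2)
      (fun t ht ↦ (hu'.2 t ⟨by linarith [ht.1], by linarith [ht.2]⟩).1.continuousAt
        |>.continuousWithinAt)
      (fun t ht ↦ (hu'.2 t ⟨by linarith [ht.1], by linarith [ht.2]⟩).1.hasDerivWithinAt)
      (fun t ht ↦ (hu'.2 t ⟨by linarith [ht.1], by linarith [ht.2]⟩).2.2)
      (by simp [(hβ v hv).1, huv]) (left_mem_Icc.2 hT₀.le)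
    simpa [hu'.1] using this
  refine ⟨α, fun v ↦ β v (-T), ?_, ?_, hAT, ?_, ?_, ?_, ?_⟩
  · filter_upwards [ball_mem_nhds _ hr₁] with u hu
    refine ⟨(hα u hu).1, fun t ht ↦ ?_⟩
    filter_upwards [Ioo_mem_nhds (show -ε₁ < t by linarith [ht.1])
      (show t < ε₁ by linarith [ht.2])] with t' ht'
    exact ⟨((hα u hu).2 t' ht').1, ((hα u hu).2 t' ht').2.1⟩
  · exact (hαc T ⟨by linarith, hT₁⟩).continuousAt (ball_mem_nhds _ hr₁)
  · exact (hβc (-T) ⟨by linarith, by linarith⟩).continuousAt (isOpen_ball.mem_nhds hT)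
  · exact hJ (hback _ (mem_ball_self hr₁) _ hT hAT.symm)
  · exact (hq.2 T ⟨by linarith, hT₂⟩).2.1
  · filter_upwards [prod_mem_prod (ball_mem_nhds _ hr₁) (isOpen_ball.mem_nhds hT)] with p hp h
    exact hback _ hp.1 _ hp.2 h

end ODE

/-! ### Tangent vector fields in charts and their integral curves -/

section IntegralCurves

variable {E F : Type*} [NormedAddCommGroup E] [NormedSpace ℝ E]
  [NormedAddCommGroup F] [NormedSpace ℝ F]
  {M : Type*} [TopologicalSpace M] [ChartedSpace E M]
  {L : Type*} [TopologicalSpace L] [ChartedSpace F L]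

/-- Charts `φ` and `ψ` in which `ι` is the restriction of a linear map `J` with left inverse `R`. -/
structure IsAdaptedCharts (ι : L → M) (φ : OpenPartialHomeomorph L F)
    (ψ : OpenPartialHomeomorph M E) (J : F →L[ℝ] E) (R : E →L[ℝ] F) : Prop where
  mem_maximalAtlas_dom : φ ∈ IsManifold.maximalAtlas 𝓘(ℝ, F) ∞ L
  mem_maximalAtlas_cod : ψ ∈ IsManifold.maximalAtlas 𝓘(ℝ, E) ∞ M
  leftInverse : Function.LeftInverse R J
  mem_target : ∀ u ∈ φ.target, J u ∈ ψ.target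
  symm_apply : ∀ u ∈ φ.target, ψ.symm (J u) = ι (φ.symm u)

theorem Manifold.IsImmersionAt.exists_isAdaptedCharts {ι : L → M} {y : L}
    (h : Manifold.IsImmersionAt 𝓘(ℝ, F) 𝓘(ℝ, E) ∞ ι y) :
    ∃ (φ : OpenPartialHomeomorph L F) (ψ : OpenPartialHomeomorph M E) (J : F →L[ℝ] E)
      (R : E →L[ℝ] F), IsAdaptedCharts ι φ ψ J R ∧ y ∈ φ.source := by
  have hw := h.writtenInCharts
  have hJ : ∀ u ∈ h.domChart.target, h.equiv (u, 0) = h.codChart (ι (h.domChart.symm u)) := by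
    intro u hu
    simpa using (hw (x := u) (by simpa using hu)).symm
  have hsrc : ∀ u ∈ h.domChart.target, ι (h.domChart.symm u) ∈ h.codChart.source :=
    fun u hu ↦ h.source_subset_preimage_source (h.domChart.map_target hu)
  refine ⟨h.domChart, h.codChart,
    h.equiv.toContinuousLinearMap ∘L ContinuousLinearMap.inl ℝ F h.complement,
    ContinuousLinearMap.fst ℝ F h.complement ∘L h.equiv.symm.toContinuousLinearMap,
    ⟨h.domChart_mem_maximalAtlas, h.codChart_mem_maximalAtlas, fun u ↦ by simp, fun u hu ↦ ?_,
      fun u hu ↦ ?_⟩, h.mem_domChart_source⟩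
  · simpa [hJ u hu] using h.codChart.map_source (hsrc u hu)
  · simp [hJ u hu, h.codChart.left_inv (hsrc u hu)]

theorem OpenPartialHomeomorph.mdifferentiable_of_mem_maximalAtlas
    {ψ : OpenPartialHomeomorph M E} (hψ : ψ ∈ IsManifold.maximalAtlas 𝓘(ℝ, E) ∞ M) :
    ψ.MDifferentiable 𝓘(ℝ, E) 𝓘(ℝ, E) :=
  ⟨(contMDiffOn_of_mem_maximalAtlas hψ).mdifferentiableOn (by simp),
    (contMDiffOn_symm_of_mem_maximalAtlas hψ).mdifferentiableOn (by simp)⟩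

/-- The expression of a vector field in a chart. -/
noncomputable def chartVectorField (ψ : OpenPartialHomeomorph M E)
    (X : ∀ x : M, TangentSpace 𝓘(ℝ, E) x) : E → E :=
  VectorField.mpullback 𝓘(ℝ, E) 𝓘(ℝ, E) ψ.symm X

section chartVectorField

variable {ψ : OpenPartialHomeomorph M E} (hψ : ψ ∈ IsManifold.maximalAtlas 𝓘(ℝ, E) ∞ M)
  {X : ∀ x : M, TangentSpace 𝓘(ℝ, E) x}

include hψ

theorem isInvertible_mfderiv_symm {u : E} (hu : u ∈ ψ.target) :
    (mfderiv 𝓘(ℝ, E) 𝓘(ℝ, E) ψ.symm u).IsInvertible :=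
  ⟨(ψ.mdifferentiable_of_mem_maximalAtlas hψ).symm.mfderiv hu, rfl⟩

theorem mfderiv_symm_chartVectorField {u : E} (hu : u ∈ ψ.target) :
    mfderiv 𝓘(ℝ, E) 𝓘(ℝ, E) ψ.symm u (chartVectorField (E := E) ψ X u) = X (ψ.symm u) := by
  obtain ⟨e, he⟩ := isInvertible_mfderiv_symm hψ hu
  simp [chartVectorField, VectorField.mpullback, ← he]

theorem chartVectorField_eq_of_mfderiv_symm {u : E} (hu : u ∈ ψ.target)
    {w : TangentSpace 𝓘(ℝ, E) u} (hw : mfderiv 𝓘(ℝ, E) 𝓘(ℝ, E) ψ.symm u w = X (ψ.symm u)) :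
    chartVectorField ψ X u = w :=
  (isInvertible_mfderiv_symm hψ hu).injective
    ((mfderiv_symm_chartVectorField hψ hu).trans hw.symm)

theorem contDiffAt_chartVectorField [CompleteSpace E] [IsManifold 𝓘(ℝ, E) ∞ M]
    (hX : ContMDiff 𝓘(ℝ, E) 𝓘(ℝ, E).tangent ∞
      (fun x ↦ (⟨x, X x⟩ : TangentBundle 𝓘(ℝ, E) M))) {u : E} (hu : u ∈ ψ.target) :
    ContDiffAt ℝ 1 (chartVectorField ψ X) u := by
  refine contMDiffAt_vectorSpace_iff_contDiffAt.1 ?_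
  exact ContMDiffAt.mpullback_vectorField_preimage (n := ∞) ((hX _).of_le (by simp))
    (contMDiffAt_symm_of_mem_maximalAtlas hψ hu) (isInvertible_mfderiv_symm hψ hu)
    (WithTop.coe_le_coe.2 (le_top : (1 + 1 : ℕ∞) ≤ ⊤))

theorem isMIntegralCurveAt_symm_comp {c : ℝ → E} {t₀ : ℝ}
    (hc : ∀ᶠ t in 𝓝 t₀, HasDerivAt c (chartVectorField ψ X (c t)) t ∧ c t ∈ ψ.target) :
    IsMIntegralCurveAt (fun t ↦ ψ.symm (c t)) X t₀ := by
  filter_upwards [hc] with t ⟨h1, h2⟩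
  have h3 := ((ψ.mdifferentiable_of_mem_maximalAtlas hψ).mdifferentiableAt_symm h2).hasMFDerivAt
  have h4 := h3.comp t h1.hasFDerivAt.hasMFDerivAt
  refine h4.congr_mfderiv (ContinuousLinearMap.ext_ring ?_)
  have h5 := mfderiv_symm_chartVectorField hψ h2 (X := X)
  change mfderiv 𝓘(ℝ, E) 𝓘(ℝ, E) ψ.symm (c t) ((1 : ℝ) • chartVectorField (E := E) ψ X (c t)) =
    (1 : ℝ) • X (ψ.symm (c t))
  rwa [one_smul, one_smul]

end chartVectorField

/-- Chain rule applied to `ι ∘ φ.symm = ψ.symm ∘ J`. -/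
theorem IsAdaptedCharts.mfderiv_comp {ι : L → M} {φ : OpenPartialHomeomorph L F}
    {ψ : OpenPartialHomeomorph M E} {J : F →L[ℝ] E} {R : E →L[ℝ] F}
    (h : IsAdaptedCharts ι φ ψ J R) {u : F} (hu : u ∈ φ.target)
    (hι : MDifferentiableAt 𝓘(ℝ, F) 𝓘(ℝ, E) ι (φ.symm u)) (w : F) :
    mfderiv 𝓘(ℝ, F) 𝓘(ℝ, E) ι (φ.symm u) (mfderiv 𝓘(ℝ, F) 𝓘(ℝ, F) φ.symm u w) =
      mfderiv 𝓘(ℝ, E) 𝓘(ℝ, E) ψ.symm (J u) (J w) := by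
  have h1 := hι.hasMFDerivAt.comp u ((φ.mdifferentiable_of_mem_maximalAtlas
    h.mem_maximalAtlas_dom).mdifferentiableAt_symm hu).hasMFDerivAt
  have h2 := ((ψ.mdifferentiable_of_mem_maximalAtlas
    h.mem_maximalAtlas_cod).mdifferentiableAt_symm (h.mem_target u hu)).hasMFDerivAt.comp u
    J.hasFDerivAt.hasMFDerivAt
  have h3 : ι ∘ φ.symm =ᶠ[𝓝 u] ψ.symm ∘ J := by
    filter_upwards [φ.open_target.mem_nhds hu] with v hv using (h.symm_apply v hv).symm
  exact DFunLike.congr_fun (hasMFDerivAt_unique h1 (h2.congr_of_eventuallyEq h3)) w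

section Tangent

variable {ι : L → M} {X : ∀ x : M, TangentSpace 𝓘(ℝ, E) x}

/-- In adapted charts, a vector field tangent to `ι` restricts along `J`. -/
theorem IsAdaptedCharts.apply_chartVectorField {φ : OpenPartialHomeomorph L F}
    {ψ : OpenPartialHomeomorph M E} {J : F →L[ℝ] E} {R : E →L[ℝ] F}
    (h : IsAdaptedCharts ι φ ψ J R) (hι : MDifferentiable 𝓘(ℝ, F) 𝓘(ℝ, E) ι)
    (hX : ∀ y, ∃ w : TangentSpace 𝓘(ℝ, F) y, mfderiv 𝓘(ℝ, F) 𝓘(ℝ, E) ι y w = X (ι y))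
    {u : F} (hu : u ∈ φ.target) :
    J (R (chartVectorField ψ X (J u))) = chartVectorField ψ X (J u) := by
  obtain ⟨w, hw⟩ := hX (φ.symm u)
  obtain ⟨w', rfl⟩ := (isInvertible_mfderiv_symm h.mem_maximalAtlas_dom hu).surjective w
  rw [chartVectorField_eq_of_mfderiv_symm (w := J w') h.mem_maximalAtlas_cod (h.mem_target u hu)]
  · exact congrArg J (h.leftInverse w')
  rw [h.symm_apply u hu, ← hw]
  exact (h.mfderiv_comp hu (hι _) w').symm

variable [CompleteSpace E] [CompleteSpace F] [IsManifold 𝓘(ℝ, E) ∞ M]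
  (hXs : ContMDiff 𝓘(ℝ, E) 𝓘(ℝ, E).tangent ∞ (fun x ↦ (⟨x, X x⟩ : TangentBundle 𝓘(ℝ, E) M)))
  (hι : Manifold.IsImmersion 𝓘(ℝ, F) 𝓘(ℝ, E) ∞ ι)
  (hX : ∀ y, ∃ w : TangentSpace 𝓘(ℝ, F) y, mfderiv 𝓘(ℝ, F) 𝓘(ℝ, E) ι y w = X (ι y))

include hXs hι hX

/-- In adapted charts the flows of the expressions of a tangent vector field are intertwined. -/
theorem IsAdaptedCharts.exists_flows {φ : OpenPartialHomeomorph L F}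
    {ψ : OpenPartialHomeomorph M E} {J : F →L[ℝ] E} {R : E →L[ℝ] F}
    (h : IsAdaptedCharts ι φ ψ J R) {q : F} (hq : q ∈ φ.target) :
    ∃ δ : ℝ → F, δ 0 = q ∧
      (∀ᶠ t in 𝓝 0, HasDerivAt δ (R (chartVectorField ψ X (J (δ t)))) t) ∧
      ∀ᶠ T in 𝓝[>] (0 : ℝ), ∃ (A : E → ℝ → E) (B : F → F),
        (∀ᶠ u in 𝓝 (J q), A u 0 = u ∧ ∀ t ∈ Icc 0 T, ∀ᶠ s in 𝓝 t,
          HasDerivAt (A u) (chartVectorField ψ X (A u s)) s ∧ A u s ∈ ψ.target) ∧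
        ContinuousAt (fun u ↦ A u T) (J q) ∧ A (J q) T = J (δ T) ∧
        ContinuousAt B (δ T) ∧ B (δ T) = q ∧ δ T ∈ φ.target ∧
        ∀ᶠ p in 𝓝 (J q) ×ˢ 𝓝 (δ T), J p.2 = A p.1 T → J (B p.2) = p.1 := by
  have hV := contDiffAt_chartVectorField h.mem_maximalAtlas_cod hXs (h.mem_target q hq)
  exact exists_intertwined_flows J h.leftInverse.injective hV
    (W := fun v ↦ R (chartVectorField ψ X (J v)))
    (R.contDiff.contDiffAt.comp q (hV.comp q J.contDiff.contDiffAt))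
    (φ.open_target.mem_nhds hq)
    (fun v hv ↦ h.apply_chartVectorField (hι.contMDiff.mdifferentiable (by simp)) hX hv)
    (ψ.open_target.mem_nhds (h.mem_target q hq))

/-- Supplies integral curves lying in the range of `ι`, to be compared with those in `M` by
uniqueness. -/
theorem exists_isMIntegralCurveAt_comp (y : L) :
    ∃ c : ℝ → L, c 0 = y ∧ IsMIntegralCurveAt (ι ∘ c) X 0 := by
  obtain ⟨φ, ψ, J, R, h, hy⟩ := Manifold.IsImmersionAt.exists_isAdaptedCharts (hι.isImmersionAt y)
  have hq := φ.map_source hy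
  obtain ⟨δ, h0, hδ, -⟩ := h.exists_flows hXs hι hX hq
  have hδc : ContinuousAt δ 0 := hδ.self_of_nhds.continuousAt
  have hφ : ∀ᶠ t in 𝓝 0, δ t ∈ φ.target :=
    hδc.preimage_mem_nhds (φ.open_target.mem_nhds (h0 ▸ hq))
  refine ⟨fun t ↦ φ.symm (δ t), by simp [h0, hy], ?_⟩
  have : IsMIntegralCurveAt (fun t ↦ ψ.symm (J (δ t))) X 0 := by
    refine isMIntegralCurveAt_symm_comp h.mem_maximalAtlas_cod ?_
    filter_upwards [hδ, hφ] with t h1 h2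
    refine ⟨?_, h.mem_target _ h2⟩
    rw [← h.apply_chartVectorField (hι.contMDiff.mdifferentiable (by simp)) hX h2]
    exact J.hasFDerivAt.comp_hasDerivAt t h1
  filter_upwards [this, hφ.eventually_nhds] with t h1 h2
  have h3 : (ι ∘ fun t ↦ φ.symm (δ t)) =ᶠ[𝓝 t] fun t ↦ ψ.symm (J (δ t)) := by
    filter_upwards [h2] with s hs using (h.symm_apply _ hs).symm
  refine (h1.congr_of_eventuallyEq h3).congr_mfderiv ?_
  exact congrArg (fun x ↦ (1 : ℝ →L[ℝ] ℝ).smulRight (X x : E)) (h.symm_apply _ h2.self_of_nhds)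

/-- Integral curves of a vector field tangent to `ι` stay in the range of `ι` if it is closed. -/
theorem mem_range_of_isMIntegralCurveAt (hcl : IsClosed (range ι)) {γ : ℝ → M} {T : ℝ}
    (hT : 0 ≤ T) (hγ : ∀ t ∈ Icc 0 T, IsMIntegralCurveAt γ X t) (h0 : γ 0 ∈ range ι) :
    γ T ∈ range ι := by
  have hγc : ContinuousOn γ (Icc 0 T) := fun t ht ↦ (hγ t ht).continuousAt.continuousWithinAt
  have hclosed : IsClosed (γ ⁻¹' range ι ∩ Icc 0 T) := by
    rw [inter_comm]
    exact hγc.preimage_isClosed_of_isClosed isClosed_Icc hcl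
  -- Continuous induction on `[0, T]`: the times spent in the range form a closed set, which local
  -- uniqueness makes open to the right.
  refine hclosed.Icc_subset_of_forall_mem_nhdsWithin h0 (fun t ht ↦ ?_) (right_mem_Icc.2 hT)
  obtain ⟨⟨y, hy⟩, ht⟩ := ht
  obtain ⟨c, hc0, hc⟩ := exists_isMIntegralCurveAt_comp hXs hι hX y
  have hc' : IsMIntegralCurveAt ((ι ∘ c) ∘ (· - t)) X t := by
    simpa [← sub_eq_add_neg] using hc.comp_add (-t)
  have := isMIntegralCurveAt_eventuallyEq_of_contMDiffAt_boundaryless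
    ((hXs _).of_le (by simp)) (hγ t (Ico_subset_Icc_self ht)) hc' (by simp [hc0, hy])
  filter_upwards [nhdsWithin_le_nhds this] with s hs
  exact ⟨c (s - t), hs.symm⟩

/-- Being inducing propagates backwards along the short integral curves of a tangent vector field. -/
theorem IsAdaptedCharts.exists_curve_comap_nhds_le (hcl : IsClosed (range ι))
    (hi : Function.Injective ι) {φ : OpenPartialHomeomorph L F}
    {ψ : OpenPartialHomeomorph M E} {J : F →L[ℝ] E} {R : E →L[ℝ] F}
    (h : IsAdaptedCharts ι φ ψ J R) {q : F} (hq : q ∈ φ.target) :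
    ∃ δ : ℝ → F, δ 0 = q ∧ HasDerivAt δ (R (chartVectorField ψ X (J q))) 0 ∧
      ∀ᶠ T in 𝓝[>] (0 : ℝ), comap ι (𝓝 (ι (φ.symm (δ T)))) ≤ 𝓝 (φ.symm (δ T)) →
        comap ι (𝓝 (ι (φ.symm q))) ≤ 𝓝 (φ.symm q) := by
  obtain ⟨δ, h0, hδ, hflow⟩ := h.exists_flows hXs hι hX hq
  refine ⟨δ, h0, by simpa [h0] using hδ.self_of_nhds, ?_⟩
  filter_upwards [hflow, self_mem_nhdsWithin] with T ⟨A, B, hA, hAc, hAT, hBc, hBT, hδT, hAB⟩ hT hgood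
  have hT' : (0 : ℝ) ≤ T := le_of_lt hT
  have hJq := h.mem_target q hq
  -- The goal is that the identity tends to `φ.symm q` along `l`.
  set l := comap ι (𝓝 (ι (φ.symm q)))
  have hιl : Tendsto ι l (𝓝 (ι (φ.symm q))) := tendsto_comap
  rw [← h.symm_apply q hq] at hιl
  have hsrc : ∀ᶠ y in l, ι y ∈ ψ.source :=
    hιl (ψ.open_source.mem_nhds (ψ.map_target hJq))
  have hu : Tendsto (fun y ↦ ψ (ι y)) l (𝓝 (J q)) := by
    have := (ψ.continuousAt (ψ.map_target hJq)).tendsto.comp hιl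
    rwa [ψ.right_inv hJq] at this
  have hflowl := hu hA
  have hm : Tendsto (fun y ↦ ψ.symm (A (ψ (ι y)) T)) l (𝓝 (ι (φ.symm (δ T)))) := by
    have h1 := hAc.tendsto.comp hu
    simp only [hAT] at h1
    have h2 := (ψ.symm.continuousAt (h.mem_target _ hδT)).tendsto.comp h1
    rwa [h.symm_apply _ hδT] at h2
  have hrange : ∀ᶠ y in l, ψ.symm (A (ψ (ι y)) T) ∈ range ι := by
    filter_upwards [hflowl, hsrc] with y ⟨h1, h2⟩ h3
    refine mem_range_of_isMIntegralCurveAt hXs hι hX hcl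
      (γ := fun t ↦ ψ.symm (A (ψ (ι y)) t)) hT'
      (fun t ht ↦ isMIntegralCurveAt_symm_comp h.mem_maximalAtlas_cod (h2 t ht)) ?_
    simp [h1, ψ.left_inv h3]
  have : Nonempty L := ⟨φ.symm q⟩
  -- The lift to `L` of the time `T` flow of `ι y`; goodness at `φ.symm (δ T)` makes it converge in
  -- `L`.
  set k : L → L := fun y ↦ Function.invFun ι (ψ.symm (A (ψ (ι y)) T))
  have hιk : ∀ᶠ y in l, ι (k y) = ψ.symm (A (ψ (ι y)) T) := by
    filter_upwards [hrange] with y hy using Function.invFun_eq hy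
  have hkl : Tendsto k l (𝓝 (φ.symm (δ T))) := by
    refine Tendsto.mono_right (tendsto_comap_iff.2 (hm.congr' ?_)) hgood
    filter_upwards [hιk] with y hy using hy.symm
  have hφs := φ.map_target hδT
  have hv : Tendsto (fun y ↦ φ (k y)) l (𝓝 (δ T)) := by
    have := (φ.continuousAt hφs).tendsto.comp hkl
    rwa [φ.right_inv hδT] at this
  have hB : Tendsto (fun y ↦ B (φ (k y))) l (𝓝 q) := by
    have := hBc.tendsto.comp hv
    rwa [hBT] at this
  have hz : Tendsto (fun y ↦ φ.symm (B (φ (k y)))) l (𝓝 (φ.symm q)) :=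
    (φ.symm.continuousAt hq).tendsto.comp hB
  -- Flowing `k y` back in `L` recovers `y`: the images agree and `ι` is injective.
  refine tendsto_id'.1 (hz.congr' ?_)
  filter_upwards [hιk, hsrc, hflowl, hkl (φ.open_source.mem_nhds hφs),
    hB (φ.open_target.mem_nhds hq), (hu.prodMk hv) hAB] with y h1 h2 h3 h4 h5 h6
  have hJk : J (φ (k y)) = A (ψ (ι y)) T := by
    have h7 := h.symm_apply _ (φ.map_source h4)
    rw [φ.left_inv h4, h1] at h7
    exact ψ.symm.injOn (h.mem_target _ (φ.map_source h4))
      (h3.2 T (right_mem_Icc.2 hT')).self_of_nhds.2 h7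
  apply hi
  rw [id, ← h.symm_apply _ h5, h6 hJk, ψ.left_inv h2]

end Tangent

end IntegralCurves

/-! ### Hamiltonian directions and touching balls -/

section Propagation

variable {E F : Type*} [NormedAddCommGroup E] [NormedSpace ℝ E]
  [NormedAddCommGroup F] [NormedSpace ℝ F]
  {M : Type*} [TopologicalSpace M] [ChartedSpace E M]
  {L : Type*} [TopologicalSpace L] [ChartedSpace F L]

/-- Every covector is the differential of a smooth function. -/
theorem exists_contMDiff_mvfderiv_eq [FiniteDimensional ℝ E] [T2Space M] [IsManifold 𝓘(ℝ, E) ∞ M]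
    (x : M) (α : TangentSpace 𝓘(ℝ, E) x →L[ℝ] ℝ) :
    ∃ f : M → ℝ, ContMDiff 𝓘(ℝ, E) 𝓘(ℝ, ℝ) ∞ f ∧ mvfderiv 𝓘(ℝ, E) f x = α := by
  let b : SmoothBumpFunction 𝓘(ℝ, E) x := Classical.arbitrary _
  let a : E →L[ℝ] ℝ := α
  refine ⟨fun y ↦ b y • a (extChartAt 𝓘(ℝ, E) x y), b.contMDiff_smul ?_, ?_⟩
  · exact a.contMDiff.comp_contMDiffOn contMDiffOn_extChartAt
  · have h1 : HasMFDerivAt 𝓘(ℝ, E) 𝓘(ℝ, ℝ) (a ∘ extChartAt 𝓘(ℝ, E) x) x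
        (a ∘L mfderiv 𝓘(ℝ, E) 𝓘(ℝ, E) (extChartAt 𝓘(ℝ, E) x) x) :=
      a.hasFDerivAt.hasMFDerivAt.comp x
        (mdifferentiableAt_extChartAt (mem_chart_source E x)).hasMFDerivAt
    have h2 : (fun y ↦ b y • a (extChartAt 𝓘(ℝ, E) x y)) =ᶠ[𝓝 x] a ∘ extChartAt 𝓘(ℝ, E) x := by
      filter_upwards [b.eventuallyEq_one] with y hy
      simp [hy]
    have h3 := (h1.congr_of_eventuallyEq h2).mfderiv
    rw [mfderiv_extChartAt_self] at h3
    ext v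
    exact DFunLike.congr_fun h3 v

/-- A curve with initial velocity pointing to the centre of a ball enters the ball. -/
theorem eventually_mem_ball_of_hasDerivAt {δ : ℝ → F} {a q : F} (h0 : δ 0 = q)
    (hδ : HasDerivAt δ (a - q) 0) (hr : 0 < dist q a) :
    ∀ᶠ t in 𝓝[>] (0 : ℝ), δ t ∈ ball a (dist q a) := by
  have h1 := (hasDerivAt_iff_isLittleO_nhds_zero.1 hδ).def (half_pos hr)
  filter_upwards [nhdsWithin_le_nhds h1, self_mem_nhdsWithin,
    nhdsWithin_le_nhds (Iio_mem_nhds zero_lt_one)] with t ht ht0 ht1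
  simp only [mem_Ioi, mem_Iio] at ht0 ht1
  rw [zero_add, h0, Real.norm_eq_abs, abs_of_pos ht0] at ht
  rw [mem_ball, dist_eq_norm, dist_eq_norm] at *
  calc ‖δ t - a‖ = ‖(δ t - q - t • (a - q)) + (1 - t) • (q - a)‖ := by congr 1; module
    _ ≤ ‖q - a‖ / 2 * t + (1 - t) * ‖q - a‖ := by
      refine (norm_add_le _ _).trans (add_le_add ht ?_)
      rw [norm_smul, Real.norm_eq_abs, abs_of_pos (by linarith)]
    _ < ‖q - a‖ := by nlinarith

/-- If `w` lies in the closure of an open set `G` but not in `G`, there is a ball in `G` near `w`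
touching the complement of `G`. -/
theorem exists_ball_subset_dist_eq {Z : Type*} [NormedAddCommGroup Z] [ProperSpace Z] {G U : Set Z}
    (hU : IsOpen U) {w : Z} (hwU : w ∈ U) (hG : IsOpen (G ∩ U)) (hw : w ∈ closure G) (hwG : w ∉ G) :
    ∃ a q, q ∈ U ∧ q ∉ G ∧ 0 < dist q a ∧ ball a (dist q a) ⊆ G ∩ U := by
  obtain ⟨ρ, hρ, hρU⟩ := nhds_basis_closedBall.mem_iff.1 (hU.mem_nhds hwU)
  -- With `a` within `ρ / 2` of the bad point `w`, the ball about `a` reaching the nearest bad point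
  -- `q` stays inside `closedBall w ρ`.
  obtain ⟨a, haG, haw⟩ := Metric.mem_closure_iff.1 hw (ρ / 2) (half_pos hρ)
  have haw' : dist a w < ρ / 2 := by rwa [dist_comm]
  have haU : a ∈ U := hρU (mem_closedBall.2 (by linarith))
  have hK : IsCompact (closedBall w ρ \ (G ∩ U)) := (isCompact_closedBall w ρ).diff hG
  obtain ⟨q, hqK, hq⟩ := hK.exists_infDist_eq_dist
    ⟨w, mem_closedBall_self hρ.le, fun h ↦ hwG h.1⟩ a
  have hqG : q ∉ G := fun h ↦ hqK.2 ⟨h, hρU hqK.1⟩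
  have hqw : dist a q ≤ dist a w :=
    hq.symm.trans_le (infDist_le_dist_of_mem ⟨mem_closedBall_self hρ.le, fun h ↦ hwG h.1⟩)
  refine ⟨a, q, hρU hqK.1, hqG, dist_pos.2 fun h ↦ hqG (h ▸ haG), fun v hv ↦ ?_⟩
  by_contra hvG
  rw [mem_ball, dist_comm q, ← hq, dist_comm] at hv
  refine (infDist_le_dist_of_mem (s := closedBall w ρ \ (G ∩ U)) ⟨?_, hvG⟩).not_gt hv
  rw [mem_closedBall]
  have := dist_triangle_left v w a
  linarith

end Propagation

/-! ### The good set is clopen -/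

theorem proposition2 {n : ℕ} {M : Type u} [TopologicalSpace M] [T2Space M]
    [SecondCountableTopology M] [ChartedSpace (EuclideanSpace ℝ (Fin n)) M]
    [IsManifold (𝓡 n) ∞ M] (P : PoissonStructure n M)
    {d : ℕ} {L : Type v} [TopologicalSpace L] [ChartedSpace (EuclideanSpace ℝ (Fin d)) L]
    [IsManifold (𝓡 d) ∞ L] (ι : L → M) (hι : P.IsSymplecticLeaf (d := d) ι)
    (hclosed : IsClosed (Set.range ι)) :
    Manifold.IsSmoothEmbedding (𝓡 d) (𝓡 n) ∞ ι := by
  obtain ⟨⟨hconn, hsc, hinj, himm, htan⟩, -⟩ := hι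
  have hcont : Continuous ι := himm.contMDiff.continuous
  have hdiff : MDifferentiable (𝓡 d) (𝓡 n) ι := himm.contMDiff.mdifferentiable (by simp)
  have : LocallyCompactSpace M := ChartedSpace.locallyCompactSpace (EuclideanSpace ℝ (Fin n)) M
  have : LocallyCompactSpace L := ChartedSpace.locallyCompactSpace (EuclideanSpace ℝ (Fin d)) L
  set G : Set L := {y | comap ι (𝓝 (ι y)) ≤ 𝓝 y}
  have hGopen : IsOpen G := isOpen_setOf_comap_nhds_le hcont hinj
  have hGclosed : IsClosed G := by
    refine isClosed_of_closure_subset fun w hw ↦ ?_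
    by_contra hwG
    obtain ⟨φ, ψ, J, R, h, hwφ⟩ :=
      Manifold.IsImmersionAt.exists_isAdaptedCharts (himm.isImmersionAt w)
    have hsymm : φ.symm (φ w) = w := φ.left_inv hwφ
    obtain ⟨a, q, hqφ, hqG, hr, hball⟩ := exists_ball_subset_dist_eq (G := φ.symm ⁻¹' G)
      φ.open_target (φ.map_source hwφ)
      (by rw [inter_comm]; exact φ.symm.isOpen_inter_preimage hGopen)
      (by
        refine mem_closure_iff_frequently.2 ((φ.continuousAt hwφ).tendsto.frequently
          (((mem_closure_iff_frequently.1 hw).and_eventually (φ.open_source.mem_nhds hwφ)).mono ?_))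
        rintro y ⟨hyG, hyφ⟩
        rwa [mem_preimage, φ.left_inv hyφ])
      (by simpa [hsymm] using hwG)
    -- The inward direction `a - q` is tangent to the leaf, so it comes from a covector, which is
    -- then realised as a differential `df`.
    obtain ⟨α, hα⟩ : mfderiv (𝓡 d) (𝓡 n) ι (φ.symm q)
        (mfderiv (𝓡 d) (𝓡 d) φ.symm q (a - q : EuclideanSpace ℝ (Fin d))) ∈
          LinearMap.range (P.sharp (ι (φ.symm q))) := by
      rw [← htan]
      exact ⟨_, rfl⟩
    obtain ⟨f, hf, rfl⟩ := exists_contMDiff_mvfderiv_eq _ α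
    have htangent : ∀ y, ∃ w : TangentSpace (𝓡 d) y,
        mfderiv (𝓡 d) (𝓡 n) ι y w = P.sharp (ι y) (mvfderiv (𝓡 n) f (ι y)) := by
      intro y
      have : P.sharp (ι y) (mvfderiv (𝓡 n) f (ι y)) ∈ LinearMap.range (P.sharp (ι y)) := ⟨_, rfl⟩
      rwa [← htan] at this
    obtain ⟨δ, h0, hδ, hT⟩ := h.exists_curve_comap_nhds_le (P.smooth f hf) himm htangent
      hclosed hinj hqφ
    have hW : R (chartVectorField ψ (fun x ↦ P.sharp x (mvfderiv (𝓡 n) f x)) (J q)) = a - q := by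
      rw [chartVectorField_eq_of_mfderiv_symm (w := J (a - q)) h.mem_maximalAtlas_cod
        (h.mem_target q hqφ)]
      · exact h.leftInverse (a - q)
      · rw [← h.mfderiv_comp hqφ (hdiff _), ← hα, h.symm_apply q hqφ]
    rw [hW] at hδ
    -- For small `T > 0` the curve from `q` is in the ball of good points, which forces `q` to be
    -- good.
    obtain ⟨T, hTball, hTgood⟩ := ((eventually_mem_ball_of_hasDerivAt h0 hδ hr).and hT).exists
    exact hqG (hTgood (hball hTball).1)
  have hGuniv : G = univ :=
    IsClopen.eq_univ ⟨hGclosed, hGopen⟩ (exists_comap_nhds_le hcont hinj hclosed)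
  have hind : Topology.IsInducing ι := isInducing_iff_nhds.2 fun y ↦
    le_antisymm (map_le_iff_le_comap.1 hcont.continuousAt) (hGuniv ▸ mem_univ y : y ∈ G)
  exact ⟨himm, hind, hinj⟩
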